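/- Let $(X,d)$ be a CAT(0) space. A subset of $X$ is convex if it contains every geodesic joining two of its points; $[x,y]$ denotes the geodesic segment from $x$ to $y$. A \emph{reflection} of $X$ is an isometry $r$ of $X$ onto itself such that $r^2=1$, the fixed-point set $F_r$ of $r$ has empty interior, and $X\setminus F_r$ has exactly two connected components, which are both convex and are interchanged by $r$. Let $W$ be a group of isometries of $X$ that is generated by a set of reflections and acts properly on $X$, that is, $\{g\in W : gx\in B(x,N)\}$ is finite for all $x\in X$ and $N>0$. Let $R$ be the set of all reflections of $X$ contained in $W$; the connected components of $X\setminus\bigcup_{r\in R}F_r$ are called chambers. Suppose that $W$ is a \emph{cocompact discrete reflection group} of $X$, that is, for a chamber $C$ the closure $\overline{C}$ is compact and $\{g\in W : gC=C\}=\{1\}$ (these conditions do not depend on the choice of the chamber). Fix a chamber $C$. For $r\in R$ let $X_r^+$ be the component of $X\setminus F_r$ that contains $C$. Let $S\subset R$ be a minimal subset such that $C=\bigcap_{s\in S}X_s^+$, i.e. $C\neq\bigcap_{s\in S\setminus\{s_0\}}X_s^+$ for every $s_0\in S$. Theorem. Let $x_0\in C$ and $w\in W$. Then there is a reduced representation $w=s_1\cdots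 s_l$ (that is, $s_1,\dots,s_l\in S$, and $l$ is the least length of a word over $S$ representing $w$) such that $$d_H\bigl([x_0,wx_0],\,P_{s_1,\dots,s_l}\bigr)\le \operatorname{diam}\overline{C},$$ where $d_H$ is the Hausdorff distance and $$P_{s_1,\dots,s_l}=[x_0,s_1x_0]\cup[s_1x_0,(s_1s_2)x_0]\cup\cdots\cup[(s_1\cdots s_{l-1})x_0,wx_0],$$ with $P=\{x_0\}$ when $l=0$. -/

import Mathlib

namespace ReflCAT0

open Set Metric

section Geodesics

variable {X : Type*} [MetricSpace X]

/-- `ξ` restricted to `[0, d(x,y)]` is a geodesic from `x` to `y`: an isometric embedding of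
the interval `[0, d(x,y)]` into `X` with `ξ 0 = x` and `ξ (d(x,y)) = y`. -/
structure IsGeodesic (ξ : ℝ → X) (x y : X) : Prop where
  isometric : ∀ s ∈ Icc (0 : ℝ) (dist x y), ∀ t ∈ Icc (0 : ℝ) (dist x y),
    dist (ξ s) (ξ t) = |s - t|
  source : ξ 0 = x
  target : ξ (dist x y) = y

/-- The geodesic segment `[x,y]`: the points lying on a geodesic from `x` to `y`. In a `CAT(0)`
space the geodesic from `x` to `y` is unique, and this is its image. -/
def geodSegment (x y : X) : Set X :=
  {z | ∃ ξ : ℝ → X, IsGeodesic ξ x y ∧ ∃ t ∈ Icc (0 : ℝ) (dist x y), ξ t = z}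

/-- A set is convex if it contains every geodesic joining two of its points. -/
def GeodConvex (A : Set X) : Prop :=
  ∀ x ∈ A, ∀ y ∈ A, geodSegment x y ⊆ A

variable (X) in
/-- Every two points are joined by a geodesic. -/
def IsGeodesicSpace : Prop :=
  ∀ x y : X, ∃ ξ : ℝ → X, IsGeodesic ξ x y

variable (X) in
/-- A `CAT(0)` space: a geodesic space in which geodesic triangles are not thicker than their
Euclidean comparison triangles. Two points `p`, `q` on different sides of a triangle lie on two
sides with a common vertex, which is called `x` here; `x' y' z'` is a comparison triangle in the
plane and `p'`, `q'` are the comparison points of `p`, `q`. (For two points on the same side the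
comparison inequality is an equality.) -/
structure IsCAT0 : Prop where
  geodesic : IsGeodesicSpace X
  comparison : ∀ x y z : X, ∀ p ∈ geodSegment x y, ∀ q ∈ geodSegment x z,
    ∀ x' y' z' : EuclideanSpace ℝ (Fin 2),
      dist x' y' = dist x y → dist y' z' = dist y z → dist x' z' = dist x z →
      ∀ p' ∈ segment ℝ x' y', ∀ q' ∈ segment ℝ x' z',
        dist x' p' = dist x p → dist x' q' = dist x q →
        dist p q ≤ dist p' q'

end Geodesics

/-- The set of connected components of a subset `U` of a topological space. -/
def componentsOf {X : Type*} [TopologicalSpace X] (U : Set X) : Set (Set X) :=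
  {A | ∃ x ∈ U, A = connectedComponentIn U x}

section Reflections

variable {X : Type*} [MetricSpace X]

/-- The fixed-point set `F_r` of an isometry `r`, called its wall when `r` is a reflection. -/
def wall (r : X ≃ᵢ X) : Set X := {x | r x = x}

/-- Reflections: involutive isometries whose fixed-point set has empty interior and a complement
with exactly two connected components, both of them convex, which are interchanged. -/
structure IsReflection (r : X ≃ᵢ X) : Prop where
  sq_eq_one : r * r = 1
  interior_wall : interior (wall r) = ∅
  two_halves : ∃ A B : Set X, A ≠ B ∧ componentsOf (wall r)ᶜ = {A, B} ∧
    GeodConvex A ∧ GeodConvex B ∧ r '' A = B ∧ r '' B = A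

/-- The set `R` of all reflections of `X` that belong to the isometry group `W`. -/
def reflectionsIn (W : Subgroup (X ≃ᵢ X)) : Set (X ≃ᵢ X) :=
  {r | r ∈ W ∧ IsReflection r}

/-- A chamber: a connected component of the complement of the union of all walls. -/
def IsChamber (W : Subgroup (X ≃ᵢ X)) (C : Set X) : Prop :=
  C ∈ componentsOf (⋃ r ∈ reflectionsIn W, wall r)ᶜ

/-- The isometry group `W` is generated by some set of reflections of `X`. -/
def IsReflectionGroup (W : Subgroup (X ≃ᵢ X)) : Prop :=
  ∃ A : Set (X ≃ᵢ X), (∀ r ∈ A, IsReflection r) ∧ Subgroup.closure A = W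

/-- The action of `W` on `X` is proper. -/
def ActsProperly (W : Subgroup (X ≃ᵢ X)) : Prop :=
  ∀ (x : X) (N : ℝ), 0 < N → {g : X ≃ᵢ X | g ∈ W ∧ g x ∈ ball x N}.Finite

/-- Cocompact discrete reflection groups of `X`. The last two conditions do not depend on the
chamber, since `W` permutes the chambers transitively. -/
structure IsCocompactDiscreteReflectionGroup (W : Subgroup (X ≃ᵢ X)) : Prop where
  isReflectionGroup : IsReflectionGroup W
  actsProperly : ActsProperly W
  isCompact_closure : ∀ C : Set X, IsChamber W C → IsCompact (closure C)
  stabilizer_trivial : ∀ C : Set X, IsChamber W C → ∀ g ∈ W, g '' C = C → g = 1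

/-- The half-space `X_r^+`: the component of `X \ F_r` that contains the chamber `C`. -/
def posHalf (C : Set X) (r : X ≃ᵢ X) : Set X :=
  ⋃ x ∈ C, connectedComponentIn (wall r)ᶜ x

/-- `S` is a minimal set of reflections in `W` with `C = ⋂_{s ∈ S} X_s^+`. -/
structure IsMinimalReflectionSet (W : Subgroup (X ≃ᵢ X)) (C : Set X) (S : Set (X ≃ᵢ X)) :
    Prop where
  subset : S ⊆ reflectionsIn W
  eq_iInter : C = ⋂ s ∈ S, posHalf C s
  minimal : ∀ s₀ ∈ S, C ≠ ⋂ s ∈ S \ {s₀}, posHalf C s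

/-- `w = s₁ ⋯ s_l` is a reduced representation over `S`: the letters lie in `S`, and no word over
`S` that represents `w` is shorter. -/
structure IsReducedRepresentation (S : Set (X ≃ᵢ X)) (w : X ≃ᵢ X) (L : List (X ≃ᵢ X)) :
    Prop where
  mem : ∀ s ∈ L, s ∈ S
  prod_eq : L.prod = w
  minimal : ∀ L' : List (X ≃ᵢ X), (∀ s ∈ L', s ∈ S) → L'.prod = w → L.length ≤ L'.length

/-- The piecewise geodesic path
`[x₀, s₁x₀] ∪ [s₁x₀, (s₁s₂)x₀] ∪ ⋯ ∪ [(s₁⋯s_{l-1})x₀, (s₁⋯s_l)x₀]` of the word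
`L = [s₁, …, s_l]`; the set `{x₀}` only matters for the empty word, whose path is `{x₀}`. -/
def wordPath (x₀ : X) (L : List (X ≃ᵢ X)) : Set X :=
  {x₀} ∪ ⋃ i ∈ Finset.range L.length,
    geodSegment ((L.take i).prod x₀) ((L.take (i + 1)).prod x₀)

end Reflections

end ReflCAT0

/-! Follow the geodesic from `x₀` to `w x₀` through closed chambers. It leaves the closure of `g C`
at a point of the wall of some `g s g⁻¹`, `s ∈ S`, that separates `g C` from `w x₀` (`exists_exit`),
and `g s C` is taken as the next chamber. Adjacent chambers are separated by one wall only
(`eq_of_mem_separating`), so each step lowers the number of walls between the current chamber and `w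
x₀`; the same fact makes this number a lower bound for word length (`ncard_separating_le_length`).
Hence the gallery (`exists_gallery`) spells a reduced word.

Each point of the geodesic lies in the closure of some `gᵢ C`, so within the diameter of `gᵢ x₀`.
Conversely, consecutive closed chambers share a point of the geodesic; the ball around it with the
diameter as radius contains `gᵢ x₀` and `gᵢ₊₁ x₀`, and by convexity (`dist_le_max`) the segment
between them. -/

open Set Metric Topology

namespace ReflCAT0

/-! ### Geodesics and convexity of balls in CAT(0) spaces. -/

section Geodesics

variable {X : Type*} [MetricSpace X]

namespace IsGeodesic

variable {ξ : ℝ → X} {x y : X}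

theorem dist_source (h : IsGeodesic ξ x y) {t : ℝ} (ht : t ∈ Icc (0 : ℝ) (dist x y)) :
    dist x (ξ t) = t := by
  have := h.isometric 0 ⟨le_rfl, dist_nonneg⟩ t ht
  rw [h.source, zero_sub, abs_neg, abs_of_nonneg ht.1] at this
  exact this

theorem dist_of_le (h : IsGeodesic ξ x y) {a b : ℝ} (ha : 0 ≤ a) (hab : a ≤ b)
    (hb : b ≤ dist x y) : dist (ξ a) (ξ b) = b - a := by
  rw [h.isometric a ⟨ha, hab.trans hb⟩ b ⟨ha.trans hab, hb⟩, abs_sub_comm,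
    abs_of_nonneg (sub_nonneg.2 hab)]

theorem continuousOn (h : IsGeodesic ξ x y) : ContinuousOn ξ (Icc 0 (dist x y)) := by
  refine LipschitzOnWith.continuousOn (K := 1) (LipschitzOnWith.of_dist_le_mul ?_)
  intro s hs t ht
  rw [h.isometric s hs t ht, Real.dist_eq]
  simp

theorem subgeodesic (h : IsGeodesic ξ x y) {a b : ℝ} (ha : 0 ≤ a) (hab : a ≤ b)
    (hb : b ≤ dist x y) : IsGeodesic (fun t => ξ (t + a)) (ξ a) (ξ b) := by
  have hd := h.dist_of_le ha hab hb
  refine ⟨?_, by simp, by simp [hd]⟩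
  intro s hs t ht
  rw [hd] at hs ht
  rw [h.isometric (s + a) ⟨by linarith [hs.1], by linarith [hs.2]⟩ (t + a)
    ⟨by linarith [ht.1], by linarith [ht.2]⟩]
  congr 1
  ring

theorem mem_geodSegment (h : IsGeodesic ξ x y) {a b t : ℝ} (ha : 0 ≤ a) (hat : a ≤ t)
    (htb : t ≤ b) (hb : b ≤ dist x y) : ξ t ∈ geodSegment (ξ a) (ξ b) := by
  refine ⟨_, h.subgeodesic ha (hat.trans htb) hb, t - a, ?_, by simp⟩
  rw [h.dist_of_le ha (hat.trans htb) hb]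
  constructor <;> linarith

theorem comp_isometryEquiv (h : IsGeodesic ξ x y) (g : X ≃ᵢ X) :
    IsGeodesic (fun t => g (ξ t)) (g x) (g y) := by
  refine ⟨?_, by rw [h.source], by rw [g.dist_eq, h.target]⟩
  intro s hs t ht
  rw [g.dist_eq] at hs ht ⊢
  exact h.isometric s hs t ht

end IsGeodesic

theorem dist_le_of_mem_geodSegment {x y p : X} (hp : p ∈ geodSegment x y) :
    dist x p ≤ dist x y := by
  obtain ⟨ξ, h, t, ht, rfl⟩ := hp
  rw [h.dist_source ht]
  exact ht.2

theorem dist_add_dist_of_mem_geodSegment {x y p : X} (hp : p ∈ geodSegment x y) :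
    dist x p + dist p y = dist x y := by
  obtain ⟨ξ, h, t, ht, rfl⟩ := hp
  have := h.dist_of_le ht.1 ht.2 le_rfl
  rw [h.target] at this
  rw [h.dist_source ht, this]
  ring

theorem smul_mem_segment_zero_smul {E : Type*} [AddCommGroup E] [Module ℝ E] (e : E) {a c : ℝ}
    (hc : 0 ≤ c) (hca : c ≤ a) : c • e ∈ segment ℝ (0 : E) (a • e) := by
  rcases (hc.trans hca).eq_or_lt with ha | ha
  · obtain rfl : c = 0 := by linarith
    simp only [zero_smul]
    exact left_mem_segment ℝ _ _
  · refine ⟨1 - c / a, c / a, ?_, by positivity, by ring, ?_⟩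
    · rw [sub_nonneg, div_le_one ha]
      exact hca
    · rw [smul_zero, zero_add, smul_smul, div_mul_cancel₀ _ ha.ne']

/-- Two points at equal distance from the common vertex of a degenerate triangle coincide. -/
theorem IsCAT0.eq_of_degenerate (hX : IsCAT0 X) {x y z p q : X}
    (hyz : dist y z = |dist x y - dist x z|) (hp : p ∈ geodSegment x y)
    (hq : q ∈ geodSegment x z) (hpq : dist x p = dist x q) : p = q := by
  let e : EuclideanSpace ℝ (Fin 2) := EuclideanSpace.single 0 1
  have he : ∀ a b : ℝ, dist (a • e) (b • e) = |a - b| := by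
    intro a b
    rw [dist_eq_norm, ← sub_smul, norm_smul]
    simp [e]
  have he0 : ∀ b : ℝ, 0 ≤ b → dist 0 (b • e) = b := by
    intro b hb
    have := he 0 b
    rwa [zero_smul, zero_sub, abs_neg, abs_of_nonneg hb] at this
  -- The comparison triangle lies on the ray spanned by `e`, where the comparison points of `p` and
  -- `q` coincide.
  have h := hX.comparison x y z p hp q hq 0 (dist x y • e) (dist x z • e)
    (he0 _ dist_nonneg) (by rw [he, hyz]) (he0 _ dist_nonneg)
    (dist x p • e) (smul_mem_segment_zero_smul e dist_nonneg (dist_le_of_mem_geodSegment hp))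
    (dist x q • e) (smul_mem_segment_zero_smul e dist_nonneg (dist_le_of_mem_geodSegment hq))
    (he0 _ dist_nonneg) (he0 _ dist_nonneg)
  rw [hpq, dist_self] at h
  exact dist_le_zero.1 h

theorem IsCAT0.geodesic_unique (hX : IsCAT0 X) {x y : X} {ξ η : ℝ → X} (hξ : IsGeodesic ξ x y)
    (hη : IsGeodesic η x y) {t : ℝ} (ht : t ∈ Icc (0 : ℝ) (dist x y)) : ξ t = η t :=
  hX.eq_of_degenerate (z := y) (by simp) ⟨ξ, hξ, t, ht, rfl⟩ ⟨η, hη, t, ht, rfl⟩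
    (by rw [hξ.dist_source ht, hη.dist_source ht])

theorem IsCAT0.mem_geodSegment_of_dist_add (hX : IsCAT0 X) {x y z : X}
    (h : dist x y + dist y z = dist x z) : y ∈ geodSegment x z := by
  obtain ⟨ξ, hξ⟩ := hX.geodesic x z
  obtain ⟨η, hη⟩ := hX.geodesic x y
  have ht : dist x y ∈ Icc (0 : ℝ) (dist x z) :=
    ⟨dist_nonneg, by linarith [dist_nonneg (x := y) (y := z)]⟩
  refine ⟨ξ, hξ, dist x y, ht, ?_⟩
  refine hX.eq_of_degenerate (x := x) (y := z) (z := y) ?_ ⟨ξ, hξ, _, ht, rfl⟩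
    ⟨η, hη, dist x y, ⟨dist_nonneg, le_rfl⟩, hη.target⟩ (hξ.dist_source ht)
  rw [dist_comm z y, abs_of_nonneg (by linarith [ht.2])]
  linarith

/-- Metric balls are convex. -/
theorem IsCAT0.dist_le_max (hX : IsCAT0 X) {a b p z : X} (hz : z ∈ geodSegment a b) :
    dist z p ≤ max (dist a p) (dist b p) := by
  rcases (dist_nonneg (x := a) (y := b)).eq_or_lt with h0 | h0
  · have h1 := dist_le_of_mem_geodSegment hz
    rw [← h0] at h1
    rw [← dist_le_zero.1 h1]
    exact le_max_left _ _
  · set c := dist a b with hc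
    set l := dist a p with hl
    set m := dist b p with hm
    -- With base from `0` to `c • e`, the comparison apex has abscissa `u` by the law of cosines;
    -- the triangle inequalities give `u ^ 2 ≤ l ^ 2`, so the height `v` exists.
    set u := (c ^ 2 + l ^ 2 - m ^ 2) / (2 * c) with hu
    have hcu : 2 * c * u = c ^ 2 + l ^ 2 - m ^ 2 := by
      rw [hu]
      field_simp
    have hl0 : 0 ≤ l := dist_nonneg
    have hm0 : 0 ≤ m := dist_nonneg
    have t1 : c ≤ l + m := by
      have := dist_triangle a p b
      rwa [dist_comm p b] at this
    have t2 : l ≤ c + m := dist_triangle a b p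
    have t3 : m ≤ c + l := by
      have := dist_triangle b a p
      rwa [dist_comm b a] at this
    have hul : u ^ 2 ≤ l ^ 2 := by
      refine sq_le_sq.2 ?_
      rw [abs_of_nonneg hl0, abs_le]
      constructor
      · by_contra hneg
        push Not at hneg
        nlinarith [mul_lt_mul_of_pos_left hneg (by linarith : (0 : ℝ) < 2 * c)]
      · by_contra hneg
        push Not at hneg
        nlinarith [mul_lt_mul_of_pos_left hneg (by linarith : (0 : ℝ) < 2 * c)]
    have hv : √(l ^ 2 - u ^ 2) ^ 2 = l ^ 2 - u ^ 2 := Real.sq_sqrt (by linarith)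
    set v := √(l ^ 2 - u ^ 2)
    let e : EuclideanSpace ℝ (Fin 2) := EuclideanSpace.single 0 1
    have he0 : ∀ r : ℝ, 0 ≤ r → dist 0 (r • e) = r := by
      intro r hr
      rw [dist_zero_left, norm_smul]
      simp [e, abs_of_nonneg hr]
    let p' : EuclideanSpace ℝ (Fin 2) := !₂[u, v]
    have h0p : dist 0 p' = l := by
      rw [EuclideanSpace.dist_eq, Real.sqrt_eq_iff_eq_sq (by positivity) hl0]
      simp [p', Fin.sum_univ_two, Real.dist_eq]
      linarith
    have hbp : dist (c • e) p' = m := by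
      rw [EuclideanSpace.dist_eq, Real.sqrt_eq_iff_eq_sq (by positivity) hm0]
      simp [p', e, Fin.sum_univ_two, Real.dist_eq]
      linarith
    have hseg := smul_mem_segment_zero_smul e dist_nonneg (dist_le_of_mem_geodSegment hz)
    obtain ⟨η, hη⟩ := hX.geodesic a p
    have h := hX.comparison a b p z hz p ⟨η, hη, dist a p, ⟨dist_nonneg, le_rfl⟩, hη.target⟩
      0 (c • e) p' (he0 _ h0.le) hbp h0p (dist a z • e) hseg p' (right_mem_segment ℝ _ _)
      (he0 _ dist_nonneg) h0p
    refine h.trans ?_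
    have hball := (convex_closedBall p' (max l m)).segment_subset (x := 0) (y := c • e)
      (by rw [mem_closedBall, h0p]; exact le_max_left _ _)
      (by rw [mem_closedBall, hbp]; exact le_max_right _ _)
    exact hball hseg

end Geodesics

/-! ### Walls, their two sides, and conjugation. -/

section Sides

variable {X : Type*} [MetricSpace X]

/-- The component of `X \ F_r` that contains `x`. -/
def side (r : X ≃ᵢ X) (x : X) : Set X := connectedComponentIn (wall r)ᶜ x

theorem mem_wall {r : X ≃ᵢ X} {x : X} : x ∈ wall r ↔ r x = x := Iff.rfl

theorem isClosed_wall (r : X ≃ᵢ X) : IsClosed (wall r) :=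
  isClosed_eq r.continuous continuous_id

theorem side_subset (r : X ≃ᵢ X) (x : X) : side r x ⊆ (wall r)ᶜ :=
  connectedComponentIn_subset _ _

theorem mem_side_self {r : X ≃ᵢ X} {x : X} (hx : x ∉ wall r) : x ∈ side r x :=
  mem_connectedComponentIn hx

theorem side_eq {r : X ≃ᵢ X} {x y : X} (h : y ∈ side r x) : side r x = side r y :=
  connectedComponentIn_eq h

theorem mul_mul_inv_apply (g r : X ≃ᵢ X) (x : X) : (g * r * g⁻¹) (g x) = g (r x) := by
  simp

theorem wall_conj (g r : X ≃ᵢ X) : wall (g * r * g⁻¹) = g '' wall r := by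
  ext x
  obtain ⟨y, rfl⟩ := g.surjective x
  rw [mem_wall, mul_mul_inv_apply, g.injective.eq_iff, g.injective.mem_set_image, mem_wall]

theorem image_connectedComponentIn (g : X ≃ᵢ X) {U : Set X} {x : X} (hx : x ∈ U) :
    g '' connectedComponentIn U x = connectedComponentIn (g '' U) (g x) :=
  g.toHomeomorph.image_connectedComponentIn hx

theorem image_compl_isometryEquiv (g : X ≃ᵢ X) (A : Set X) : g '' Aᶜ = (g '' A)ᶜ :=
  image_compl_eq g.bijective

theorem image_side (g r : X ≃ᵢ X) {x : X} (hx : x ∉ wall r) :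
    g '' side r x = side (g * r * g⁻¹) (g x) := by
  rw [side, image_connectedComponentIn g hx, image_compl_isometryEquiv, ← wall_conj, side]

theorem apply_mem_side_conj (g r : X ≃ᵢ X) {x y : X} (hx : x ∉ wall r) :
    g y ∈ side (g * r * g⁻¹) (g x) ↔ y ∈ side r x := by
  rw [← image_side g r hx, g.injective.mem_set_image]

theorem componentsOf_image (g : X ≃ᵢ X) (U : Set X) :
    componentsOf (g '' U) = (fun A => g '' A) '' componentsOf U := by
  ext A
  constructor
  · rintro ⟨_, ⟨x, hx, rfl⟩, rfl⟩
    exact ⟨_, ⟨x, hx, rfl⟩, image_connectedComponentIn g hx⟩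
  · rintro ⟨_, ⟨x, hx, rfl⟩, rfl⟩
    exact ⟨g x, mem_image_of_mem g hx, image_connectedComponentIn g hx⟩

theorem GeodConvex.image {A : Set X} (hA : GeodConvex A) (g : X ≃ᵢ X) : GeodConvex (g '' A) := by
  rintro _ ⟨x, hx, rfl⟩ _ ⟨y, hy, rfl⟩ z ⟨ξ, hξ, t, ht, rfl⟩
  refine ⟨g⁻¹ (ξ t), hA x hx y hy ⟨_, by simpa using hξ.comp_isometryEquiv g⁻¹, t, ?_, rfl⟩,
    by simp⟩
  rwa [g.dist_eq] at ht

theorem IsReflection.conj {r : X ≃ᵢ X} (hr : IsReflection r) (g : X ≃ᵢ X) :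
    IsReflection (g * r * g⁻¹) := by
  obtain ⟨A, B, hAB, hcomp, hA, hB, hrA, hrB⟩ := hr.two_halves
  have himg : ∀ A : Set X, (g * r * g⁻¹) '' (g '' A) = g '' (r '' A) := by
    intro A
    simp only [image_image, mul_mul_inv_apply]
  refine ⟨?_, ?_, g '' A, g '' B, ?_, ?_, hA.image g, hB.image g, ?_, ?_⟩
  · calc g * r * g⁻¹ * (g * r * g⁻¹) = g * (r * r) * g⁻¹ := by group
      _ = 1 := by rw [hr.sq_eq_one]; group
  · rw [wall_conj]
    have := g.toHomeomorph.image_interior (wall r)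
    rw [hr.interior_wall, image_empty] at this
    exact this.symm
  · exact fun h => hAB (g.injective.image_injective h)
  · rw [wall_conj, ← image_compl_isometryEquiv, componentsOf_image, hcomp, image_pair]
  · rw [himg, hrA]
  · rw [himg, hrB]

namespace IsReflection

variable {r : X ≃ᵢ X}

theorem apply_apply (hr : IsReflection r) (x : X) : r (r x) = x := by
  rw [← IsometryEquiv.mul_apply, hr.sq_eq_one]
  rfl

theorem inv_eq (hr : IsReflection r) : r⁻¹ = r := inv_eq_of_mul_eq_one_left hr.sq_eq_one

theorem apply_notMem_wall (hr : IsReflection r) {x : X} (hx : x ∉ wall r) : r x ∉ wall r := by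
  intro h
  rw [mem_wall, hr.apply_apply] at h
  exact hx h.symm

theorem geodConvex_side (hr : IsReflection r) {x : X} (hx : x ∉ wall r) :
    GeodConvex (side r x) := by
  obtain ⟨A, B, hAB, hcomp, hA, hB, hrA, hrB⟩ := hr.two_halves
  have : side r x ∈ componentsOf (wall r)ᶜ := ⟨x, hx, rfl⟩
  rw [hcomp] at this
  rcases this with h | h <;> rw [h] <;> assumption

theorem apply_mem_side_iff (hr : IsReflection r) {x y : X} (hx : x ∉ wall r) (hy : y ∉ wall r) :
    r y ∈ side r x ↔ y ∉ side r x := by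
  obtain ⟨A, B, hAB, hcomp, hA, hB, hrA, hrB⟩ := hr.two_halves
  have hmem : ∀ z, z ∉ wall r → side r z = A ∨ side r z = B := by
    intro z hz
    have : side r z ∈ componentsOf (wall r)ᶜ := ⟨z, hz, rfl⟩
    rwa [hcomp] at this
  have hiff : ∀ z, z ∉ wall r → (z ∈ side r x ↔ side r x = side r z) := fun z hz =>
    ⟨side_eq, fun h => h ▸ mem_side_self hz⟩
  have hry := hr.apply_notMem_wall hy
  have himg : side r (r y) = r '' side r y := by
    rw [image_side r r hy, mul_inv_cancel_right]
  rw [hiff _ hry, hiff _ hy, himg]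
  rcases hmem x hx with h1 | h1 <;> rcases hmem y hy with h2 | h2 <;> rw [h1, h2] <;>
    simp [hrA, hrB, hAB, hAB.symm]

theorem mem_side_of_notMem_of_notMem (hr : IsReflection r) {x y z : X} (hx : x ∉ wall r)
    (hy : y ∉ wall r) (hz : z ∉ wall r) (hyx : y ∉ side r x) (hzx : z ∉ side r x) :
    z ∈ side r y := by
  rw [← hr.apply_mem_side_iff hx hy] at hyx
  rw [← hr.apply_mem_side_iff hx hz] at hzx
  by_contra h
  rw [← hr.apply_mem_side_iff hy hz] at h
  have h1 := side_eq hyx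
  have h2 := side_eq h
  have h3 := side_eq hzx
  have h4 := (hr.apply_mem_side_iff hy hy).not.2 (not_not.2 (mem_side_self hy))
  rw [h2, ← h3, h1] at h4
  exact h4 (mem_side_self (hr.apply_notMem_wall hy))

end IsReflection

/-- A geodesic that leaves a side of a wall meets the wall. -/
theorem IsGeodesic.exists_mem_wall {ξ : ℝ → X} {x y : X} (h : IsGeodesic ξ x y) {r : X ≃ᵢ X}
    {a b : ℝ} (ha : 0 ≤ a) (hab : a ≤ b) (hb : b ≤ dist x y) (hξ : ξ b ∉ side r (ξ a)) :
    ∃ t ∈ Icc a b, ξ t ∈ wall r := by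
  by_contra! hne
  have hpre : IsPreconnected (ξ '' Icc a b) :=
    isPreconnected_Icc.image ξ (h.continuousOn.mono (Icc_subset_Icc ha hb))
  refine hξ (hpre.subset_connectedComponentIn (mem_image_of_mem ξ ⟨le_rfl, hab⟩) ?_
    (mem_image_of_mem ξ ⟨hab, le_rfl⟩))
  rintro _ ⟨t, ht, rfl⟩
  exact hne t ht

theorem IsCAT0.exists_mem_wall (hX : IsCAT0 X) {r : X ≃ᵢ X} {x y : X} (h : y ∉ side r x) :
    ∃ z ∈ geodSegment x y, z ∈ wall r := by
  obtain ⟨ξ, hξ⟩ := hX.geodesic x y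
  obtain ⟨t, ht, htw⟩ := hξ.exists_mem_wall (r := r) le_rfl dist_nonneg le_rfl
    (by rwa [hξ.source, hξ.target])
  exact ⟨ξ t, ⟨ξ, hξ, t, ht, rfl⟩, htw⟩

/-- `r` sends a geodesic between fixed points to a geodesic with the same ends, so uniqueness fixes
it pointwise. -/
theorem IsCAT0.geodConvex_wall (hX : IsCAT0 X) (r : X ≃ᵢ X) : GeodConvex (wall r) := by
  rintro x hx y hy z ⟨ξ, hξ, t, ht, rfl⟩
  have h := hξ.comp_isometryEquiv r
  rw [mem_wall.1 hx, mem_wall.1 hy] at h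
  exact hX.geodesic_unique h hξ ht

theorem dist_le_of_mem_geodSegment_right {x y p : X} (hp : p ∈ geodSegment x y) :
    dist p y ≤ dist x y := by
  linarith [dist_add_dist_of_mem_geodSegment hp, dist_nonneg (x := x) (y := p)]

/-- A geodesic from a nearby point of the side to a point off that side would meet the wall inside a
ball that misses it. -/
theorem IsCAT0.closure_side_subset (hX : IsCAT0 X) (r : X ≃ᵢ X) (x : X) :
    closure (side r x) ⊆ side r x ∪ wall r := by
  intro z hz
  by_contra h
  rw [mem_union, not_or] at h
  obtain ⟨ε, hε, hball⟩ := Metric.isOpen_iff.1 (isClosed_wall r).isOpen_compl z h.2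
  obtain ⟨y, hy, hyz⟩ := Metric.mem_closure_iff.1 hz ε hε
  have hzy : z ∉ side r y := side_eq hy ▸ h.1
  obtain ⟨p, hp, hpw⟩ := hX.exists_mem_wall hzy
  refine hball ?_ hpw
  rw [mem_ball]
  exact (dist_le_of_mem_geodSegment_right hp).trans_lt (by rwa [dist_comm])

/-- Reflecting a point on the other side of the wall to the side of `x` brings it closer. -/
theorem IsReflection.dist_apply_lt {r : X ≃ᵢ X} (hX : IsCAT0 X) (hr : IsReflection r) {x q : X}
    (hx : x ∉ wall r) (hq : q ∉ wall r) (hqx : q ∉ side r x) : dist x (r q) < dist x q := by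
  obtain ⟨y, hy, hyw⟩ := hX.exists_mem_wall hqx
  have hyq : dist y (r q) = dist y q := by
    conv_lhs => rw [← mem_wall.1 hyw, r.dist_eq]
  have hadd := dist_add_dist_of_mem_geodSegment hy
  -- Equality would put the wall point `y` on a geodesic from `x` to `r q`, inside the convex side
  -- of `x`.
  refine lt_of_le_of_ne (by linarith [dist_triangle x y (r q)]) fun heq => ?_
  have hyr : y ∈ geodSegment x (r q) := hX.mem_geodSegment_of_dist_add (by linarith)
  exact side_subset r x (hr.geodConvex_side hx x (mem_side_self hx) (r q)
    ((hr.apply_mem_side_iff hx hq).2 hqx) hyr) hyw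

end Sides

/-! ### Separating walls and local finiteness. -/

section Groups

variable {X : Type*} [MetricSpace X] {W : Subgroup (X ≃ᵢ X)}

/-- The points that lie on no wall. -/
def offWalls (W : Subgroup (X ≃ᵢ X)) : Set X := (⋃ r ∈ reflectionsIn W, wall r)ᶜ

theorem mem_offWalls {x : X} : x ∈ offWalls W ↔ ∀ r ∈ reflectionsIn W, x ∉ wall r := by
  simp [offWalls]

theorem conj_mem_reflectionsIn {g r : X ≃ᵢ X} (hg : g ∈ W) (hr : r ∈ reflectionsIn W) :
    g * r * g⁻¹ ∈ reflectionsIn W :=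
  ⟨W.mul_mem (W.mul_mem hg hr.1) (W.inv_mem hg), hr.2.conj g⟩

theorem inv_conj_mem_reflectionsIn {g r : X ≃ᵢ X} (hg : g ∈ W) (hr : r ∈ reflectionsIn W) :
    g⁻¹ * r * g ∈ reflectionsIn W := by
  simpa using conj_mem_reflectionsIn (W.inv_mem hg) hr

theorem apply_mem_offWalls {g : X ≃ᵢ X} (hg : g ∈ W) {x : X} (hx : x ∈ offWalls W) :
    g x ∈ offWalls W := by
  rw [mem_offWalls] at hx ⊢
  intro r hr h
  refine hx _ (inv_conj_mem_reflectionsIn hg hr) ?_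
  rw [mem_wall] at h ⊢
  simp [h]

theorem image_offWalls {g : X ≃ᵢ X} (hg : g ∈ W) : g '' offWalls W = offWalls W := by
  refine Subset.antisymm ?_ fun x hx => ⟨g⁻¹ x, apply_mem_offWalls (W.inv_mem hg) hx, by simp⟩
  rintro _ ⟨x, hx, rfl⟩
  exact apply_mem_offWalls hg hx

theorem IsChamber.subset_offWalls {C : Set X} (hC : IsChamber W C) : C ⊆ offWalls W := by
  obtain ⟨x, hx, rfl⟩ := hC
  exact connectedComponentIn_subset _ _

theorem IsChamber.eq_connectedComponentIn {C : Set X} (hC : IsChamber W C) {x : X} (hx : x ∈ C) :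
    C = connectedComponentIn (offWalls W) x := by
  obtain ⟨y, hy, rfl⟩ := hC
  exact connectedComponentIn_eq hx

theorem IsChamber.subset_side {C : Set X} (hC : IsChamber W C) {r : X ≃ᵢ X}
    (hr : r ∈ reflectionsIn W) {x : X} (hx : x ∈ C) : C ⊆ side r x := by
  rw [hC.eq_connectedComponentIn hx]
  exact connectedComponentIn_mono _ fun y hy => mem_offWalls.1 hy r hr

theorem IsChamber.posHalf_eq {C : Set X} (hC : IsChamber W C) {r : X ≃ᵢ X}
    (hr : r ∈ reflectionsIn W) {x : X} (hx : x ∈ C) : posHalf C r = side r x := by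
  refine Subset.antisymm (iUnion₂_subset fun y hy => ?_) fun y hy => mem_iUnion₂.2 ⟨x, hx, hy⟩
  exact (side_eq (hC.subset_side hr hx hy)).ge

theorem IsChamber.image_eq {C : Set X} (hC : IsChamber W C) {g : X ≃ᵢ X} (hg : g ∈ W) {x : X}
    (hx : x ∈ C) (hgx : g x ∈ C) : g '' C = C := by
  conv_lhs => rw [hC.eq_connectedComponentIn hx]
  rw [image_connectedComponentIn g (hC.subset_offWalls hx), image_offWalls hg,
    ← hC.eq_connectedComponentIn hgx]

/-- The reflections in `W` whose walls separate `x` from `y`. -/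
def separating (W : Subgroup (X ≃ᵢ X)) (x y : X) : Set (X ≃ᵢ X) :=
  {r | r ∈ reflectionsIn W ∧ y ∉ side r x}

theorem conj_mem_separating {g r : X ≃ᵢ X} (hg : g ∈ W) {x y : X} (hx : x ∈ offWalls W)
    (hr : r ∈ separating W x y) : g * r * g⁻¹ ∈ separating W (g x) (g y) := by
  refine ⟨conj_mem_reflectionsIn hg hr.1, ?_⟩
  rw [apply_mem_side_conj g r (mem_offWalls.1 hx r hr.1)]
  exact hr.2

theorem separating_apply {g : X ≃ᵢ X} (hg : g ∈ W) {x y : X} (hx : x ∈ offWalls W) :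
    separating W (g x) (g y) = (fun r => g * r * g⁻¹) '' separating W x y := by
  refine Subset.antisymm (fun r hr => ⟨g⁻¹ * r * g, ?_, by group⟩) ?_
  · simpa using conj_mem_separating (W.inv_mem hg) (apply_mem_offWalls hg hx) hr
  · rintro _ ⟨r, hr, rfl⟩
    exact conj_mem_separating hg hx hr

theorem ncard_separating_apply {g : X ≃ᵢ X} (hg : g ∈ W) {x y : X} (hx : x ∈ offWalls W) :
    (separating W (g x) (g y)).ncard = (separating W x y).ncard := by
  rw [separating_apply hg hx]
  exact ncard_image_of_injective _ fun a b h => by simpa using h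

theorem dist_apply_le_of_mem_wall {r : X ≃ᵢ X} {y : X} (hy : y ∈ wall r) (x : X) :
    dist (r x) x ≤ 2 * dist y x := by
  have h : dist (r x) y = dist y x := by
    conv_lhs => rw [← mem_wall.1 hy, r.dist_eq, dist_comm]
  linarith [dist_triangle (r x) y x]

/-- A separating wall meets the geodesic from `x` to `y`, so its reflection moves `x` by at most `2
* dist x y`. -/
theorem ActsProperly.finite_separating (hX : IsCAT0 X) (hW : ActsProperly W) (x y : X) :
    (separating W x y).Finite := by
  refine (hW x (2 * dist x y + 1) (by linarith [dist_nonneg (x := x) (y := y)])).subset ?_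
  rintro r ⟨hr, hrxy⟩
  refine ⟨hr.1, ?_⟩
  obtain ⟨z, hz, hzw⟩ := hX.exists_mem_wall hrxy
  have h1 := dist_apply_le_of_mem_wall hzw x
  have h2 := dist_le_of_mem_geodSegment hz
  rw [dist_comm z x] at h1
  rw [mem_ball]
  linarith

/-- Every point has a ball that only meets the walls through that point. -/
theorem ActsProperly.exists_forall_mem_wall (hW : ActsProperly W) (z : X) :
    ∃ ε > 0, ∀ r ∈ reflectionsIn W, ∀ y ∈ wall r, dist y z < ε → z ∈ wall r := by
  have hfin := (hW z 2 two_pos).subset (sep_subset _ fun g => g z ≠ z)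
  have : ∃ δ > 0, ∀ g ∈ {g | g ∈ {g : X ≃ᵢ X | g ∈ W ∧ g z ∈ ball z 2} ∧ g z ≠ z},
      δ ≤ dist (g z) z := by
    rcases hfin.toFinset.eq_empty_or_nonempty with h | h
    · refine ⟨1, one_pos, fun g hg => ?_⟩
      rw [Finite.toFinset_eq_empty] at h
      rw [h] at hg
      exact hg.elim
    · obtain ⟨g₀, hg₀, hmin⟩ := hfin.toFinset.exists_min_image (fun g => dist (g z) z) h
      rw [Finite.mem_toFinset] at hg₀
      exact ⟨_, dist_pos.2 hg₀.2, fun g hg => hmin g (hfin.mem_toFinset.2 hg)⟩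
  obtain ⟨δ, hδ, hδmin⟩ := this
  -- A wall within `δ / 2` of `z` moves `z` by less than `δ`, hence not at all; the bound `1` keeps
  -- `r z` in the ball of radius `2` where `δ` is a lower bound.
  refine ⟨min 1 (δ / 2), by positivity, fun r hr y hy hyz => ?_⟩
  have h1 := dist_apply_le_of_mem_wall hy z
  rw [lt_min_iff] at hyz
  by_contra hne
  linarith [hδmin r ⟨⟨hr.1, by rw [mem_ball]; linarith⟩, hne⟩]

theorem interior_biUnion_wall {T : Set (X ≃ᵢ X)} (hT : T.Finite)
    (h : ∀ r ∈ T, interior (wall r) = ∅) : interior (⋃ r ∈ T, wall r) = ∅ := by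
  induction T, hT using Set.Finite.induction_on with
  | empty => simp
  | @insert r T hrT hT ih =>
    rw [biUnion_insert, interior_union_isClosed_of_interior_empty (isClosed_wall r)
      (ih fun s hs => h s (mem_insert_of_mem _ hs))]
    exact h r (mem_insert _ _)

/-- Only finitely many walls meet the ball, and a finite union of closed sets with empty interior
has empty interior. -/
theorem ActsProperly.exists_mem_offWalls (hW : ActsProperly W) (z : X) {ε : ℝ} (hε : 0 < ε) :
    ∃ q ∈ offWalls W, dist q z < ε := by
  let T := {r | r ∈ reflectionsIn W ∧ r z ∈ ball z (2 * ε)}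
  have hT : T.Finite := (hW z (2 * ε) (by positivity)).subset fun r hr => ⟨hr.1.1, hr.2⟩
  have hint := interior_biUnion_wall hT fun r hr => hr.1.2.interior_wall
  have hnot : ¬ ball z ε ⊆ ⋃ r ∈ T, wall r := by
    intro hsub
    have := interior_maximal hsub isOpen_ball (mem_ball_self hε)
    rw [hint] at this
    exact this
  obtain ⟨q, hq, hqT⟩ := not_subset.1 hnot
  refine ⟨q, mem_offWalls.2 fun r hr hqr => hqT (mem_biUnion (⟨hr, ?_⟩ : r ∈ T) hqr), hq⟩
  have := dist_apply_le_of_mem_wall hqr z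
  rw [mem_ball] at hq ⊢
  linarith

end Groups

/-! ### The closed chamber and its neighbours. -/

section Chambers

variable {X : Type*} [MetricSpace X] {W : Subgroup (X ≃ᵢ X)} {C : Set X} {S : Set (X ≃ᵢ X)}

theorem IsMinimalReflectionSet.mem_iff (hS : IsMinimalReflectionSet W C S) (hC : IsChamber W C)
    {x₀ : X} (hx₀ : x₀ ∈ C) {x : X} : x ∈ C ↔ ∀ s ∈ S, x ∈ side s x₀ := by
  conv_lhs => rw [hS.eq_iInter, mem_iInter₂]
  exact forall₂_congr fun s hs => by rw [hC.posHalf_eq (hS.subset hs) hx₀]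

theorem IsMinimalReflectionSet.exists_notMem_side (hS : IsMinimalReflectionSet W C S)
    (hC : IsChamber W C) {x₀ : X} (hx₀ : x₀ ∈ C) {x : X} (hx : x ∉ C) :
    ∃ s ∈ S, x ∉ side s x₀ := by
  rw [hS.mem_iff hC hx₀] at hx
  push Not at hx
  exact hx

/-- The closed chamber is the intersection of the closed half-spaces of `S`. -/
theorem IsMinimalReflectionSet.mem_closure (hX : IsCAT0 X) (hW : ActsProperly W)
    (hC : IsChamber W C) (hS : IsMinimalReflectionSet W C S) {x₀ : X} (hx₀ : x₀ ∈ C) {z : X}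
    (hz : ∀ s ∈ S, z ∈ side s x₀ ∪ wall s) : z ∈ closure C := by
  obtain ⟨ε₀, hε₀, hlocal⟩ := hW.exists_forall_mem_wall z
  rw [Metric.mem_closure_iff]
  intro ε hε
  obtain ⟨q, hq, hqz⟩ := hW.exists_mem_offWalls z (lt_min hε hε₀)
  let T := {g : X ≃ᵢ X | g ∈ W ∧ g z = z}
  have hT : T.Finite := (hW z 1 one_pos).subset fun g hg => ⟨hg.1, by
    rw [hg.2]
    exact mem_ball_self one_pos⟩
  -- Among the images of `q` under the stabilizer of `z`, the one nearest to `x₀` lies in `C`: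
  -- otherwise a reflection of `S` through `z` would bring it nearer.
  obtain ⟨g, hg, hmin⟩ := hT.toFinset.exists_min_image (fun g => dist x₀ (g q))
    ⟨1, hT.mem_toFinset.2 ⟨W.one_mem, rfl⟩⟩
  simp only [Finite.mem_toFinset] at hg hmin
  have hgq : dist (g q) z < min ε ε₀ := by
    have := g.dist_eq q z
    rw [hg.2] at this
    rwa [this]
  have hgqW := apply_mem_offWalls hg.1 hq
  refine ⟨g q, ?_, by rw [dist_comm]; exact hgq.trans_le (min_le_left _ _)⟩
  by_contra hgC
  obtain ⟨s, hs, hsq⟩ := hS.exists_notMem_side hC hx₀ hgC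
  have hsR := hS.subset hs
  have hzs : z ∈ wall s := by
    rcases hz s hs with h | h
    · rw [side_eq h] at hsq
      obtain ⟨y, hy, hyw⟩ := hX.exists_mem_wall hsq
      refine hlocal s hsR y hyw ?_
      rw [dist_comm]
      refine (dist_le_of_mem_geodSegment hy).trans_lt ?_
      rw [dist_comm]
      exact hgq.trans_le (min_le_right _ _)
    · exact h
  have hlt := hsR.2.dist_apply_lt hX (mem_offWalls.1 (hC.subset_offWalls hx₀) s hsR)
    (mem_offWalls.1 hgqW s hsR) hsq
  have hle := hmin (s * g) ⟨W.mul_mem hsR.1 hg.1, by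
    rw [IsometryEquiv.mul_apply, hg.2]
    exact hzs⟩
  exact absurd hlt (not_lt.2 hle)

theorem IsChamber.closure_subset (hX : IsCAT0 X) (hC : IsChamber W C) {r : X ≃ᵢ X}
    (hr : r ∈ reflectionsIn W) {x : X} (hx : x ∈ C) : closure C ⊆ side r x ∪ wall r :=
  (closure_mono (hC.subset_side hr hx)).trans (hX.closure_side_subset r x)

theorem IsChamber.apply_mem_of_mem_closure (hX : IsCAT0 X) (hC : IsChamber W C) {r : X ≃ᵢ X}
    (hr : r ∈ reflectionsIn W) {x y : X} (hx : x ∈ C) (hy : y ∈ closure C) {g : X ≃ᵢ X}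
    (hg : g ∈ W) : g y ∈ side r (g x) ∪ wall r := by
  have hr' := inv_conj_mem_reflectionsIn hg hr
  rcases hC.closure_subset hX hr' hx hy with h | h
  · rw [← apply_mem_side_conj g _ (mem_offWalls.1 (hC.subset_offWalls hx) _ hr')] at h
    left
    simpa [mul_assoc] using h
  · right
    have := mem_image_of_mem g h
    rw [← wall_conj] at this
    simpa [mul_assoc] using this

/-- Minimality gives a point outside `C` that violates only the half-space of `s`; the geodesic to
it from `x₀` crosses the wall of `s` inside all the other half-spaces. -/
theorem IsMinimalReflectionSet.exists_mem_wall (hX : IsCAT0 X)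
    (hC : IsChamber W C) (hS : IsMinimalReflectionSet W C S) {x₀ : X} (hx₀ : x₀ ∈ C)
    {s : X ≃ᵢ X} (hs : s ∈ S) : ∃ y ∈ wall s, ∀ s' ∈ S, s' ≠ s → y ∈ side s' x₀ := by
  have hne := hS.minimal s hs
  obtain ⟨z, hz, hzC⟩ : ∃ z, z ∈ ⋂ s' ∈ S \ {s}, posHalf C s' ∧ z ∉ C := by
    by_contra! h
    refine hne (Subset.antisymm ?_ h)
    conv_lhs => rw [hS.eq_iInter]
    exact biInter_mono sdiff_subset fun _ _ => Subset.rfl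
  rw [mem_iInter₂] at hz
  have hz' : ∀ s' ∈ S, s' ≠ s → z ∈ side s' x₀ := fun s' hs' hne' => by
    rw [← hC.posHalf_eq (hS.subset hs') hx₀]
    exact hz s' ⟨hs', hne'⟩
  have hzs : z ∉ side s x₀ := by
    intro h
    refine hzC ((hS.mem_iff hC hx₀).2 fun s' hs' => ?_)
    by_cases hss : s' = s
    · rwa [hss]
    · exact hz' s' hs' hss
  obtain ⟨y, hy, hyw⟩ := hX.exists_mem_wall hzs
  refine ⟨y, hyw, fun s' hs' hne' => ?_⟩
  have hx₀w := mem_offWalls.1 (hC.subset_offWalls hx₀) s' (hS.subset hs')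
  exact (hS.subset hs').2.geodConvex_side hx₀w x₀ (mem_side_self hx₀w) z (hz' s' hs' hne') hy

/-- Adjacent chambers are separated by a single reflection. -/
theorem IsMinimalReflectionSet.eq_of_mem_separating (hX : IsCAT0 X) (hW : ActsProperly W)
    (hstab : ∀ g ∈ W, g '' C = C → g = 1)
    (hC : IsChamber W C) (hS : IsMinimalReflectionSet W C S) {x₀ : X} (hx₀ : x₀ ∈ C)
    {s r : X ≃ᵢ X} (hs : s ∈ S) (hr : r ∈ separating W x₀ (s x₀)) : r = s := by
  have hsR := hS.subset hs
  have hx₀W := hC.subset_offWalls hx₀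
  have hx₀w : ∀ r ∈ reflectionsIn W, x₀ ∉ wall r := mem_offWalls.1 hx₀W
  obtain ⟨y, hys, hy⟩ := hS.exists_mem_wall hX hC hx₀ hs
  have hyC : y ∈ closure C := hS.mem_closure hX hW hC hx₀ fun s' hs' => by
    by_cases hss : s' = s
    · rw [hss]
      exact Or.inr hys
    · exact Or.inl (hy s' hs' hss)
  have hside : ∀ g ∈ W, g y = y → ∀ s' ∈ S, s' ≠ s → g x₀ ∈ side s' x₀ := by
    intro g hg hgy s' hs' hne
    have h := hC.apply_mem_of_mem_closure hX (hS.subset hs') hx₀ hyC hg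
    rw [hgy] at h
    rcases h with h | h
    · rw [side_eq (hy s' hs' hne), ← side_eq h]
      exact mem_side_self (mem_offWalls.1 (apply_mem_offWalls hg hx₀W) s' (hS.subset hs'))
    · exact (side_subset _ _ (hy s' hs' hne) h).elim
  -- An element of the stabilizer of `y` can only change the side of `s`, and if it does not, it
  -- preserves `C`.
  have hone : ∀ g ∈ W, g y = y → g x₀ ∈ side s x₀ → g = 1 := by
    intro g hg hgy hgs
    refine hstab g hg (hC.image_eq hg hx₀ ((hS.mem_iff hC hx₀).2 fun s' hs' => ?_))
    by_cases hss : s' = s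
    · rwa [hss]
    · exact hside g hg hgy s' hs' hss
  -- `y` lies in the closures of both `C` and `s C`, which are on opposite sides of `r`.
  have hyr : y ∈ wall r := by
    have h2 := hC.apply_mem_of_mem_closure hX hr.1 hx₀ hyC hsR.1
    rw [mem_wall.1 hys] at h2
    rcases hC.closure_subset hX hr.1 hx₀ hyC, h2 with ⟨h1 | h1, h2 | h2⟩
    · refine (hr.2 ?_).elim
      rw [side_eq h1, ← side_eq h2]
      exact mem_side_self (mem_offWalls.1 (apply_mem_offWalls hsR.1 hx₀W) r hr.1)
    all_goals assumption
  have hrs : r x₀ ∉ side s x₀ := fun h => by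
    refine hx₀w r hr.1 ?_
    rw [hone r hr.1.1 hyr h]
    rfl
  have : s * r = 1 := by
    refine hone _ (W.mul_mem hsR.1 hr.1.1) ?_ ?_
    · rw [IsometryEquiv.mul_apply, mem_wall.1 hyr, mem_wall.1 hys]
    · exact (hsR.2.apply_mem_side_iff (hx₀w s hsR)
        (mem_offWalls.1 (apply_mem_offWalls hr.1.1 hx₀W) s hsR)).2 hrs
  rw [← hsR.2.inv_eq]
  exact (inv_eq_of_mul_eq_one_right this).symm

end Chambers

/-! ### Galleries along geodesics and word length. -/

section Galleries

variable {X : Type*} [MetricSpace X] {W : Subgroup (X ≃ᵢ X)} {C : Set X} {S : Set (X ≃ᵢ X)}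

/-- Applying `s` to the pair `x₀, y` preserves the count, and replacing `s x₀` by `x₀` affects only
the wall of `s`. -/
theorem IsMinimalReflectionSet.ncard_separating_le (hX : IsCAT0 X) (hW : ActsProperly W)
    (hstab : ∀ g ∈ W, g '' C = C → g = 1)
    (hC : IsChamber W C) (hS : IsMinimalReflectionSet W C S) {x₀ : X} (hx₀ : x₀ ∈ C)
    {s : X ≃ᵢ X} (hs : s ∈ S) (y : X) :
    (separating W x₀ (s y)).ncard ≤ (separating W x₀ y).ncard + 1 := by
  have hsW := (hS.subset hs).1
  rw [← ncard_separating_apply hsW (hC.subset_offWalls hx₀) (y := y)]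
  have hfin := hW.finite_separating hX (s x₀) (s y)
  refine (ncard_le_ncard ?_ (hfin.insert s)).trans (ncard_insert_le _ _)
  rintro r ⟨hr, hry⟩
  by_cases hrs : r = s
  · exact Or.inl hrs
  · refine Or.inr ⟨hr, ?_⟩
    have hmem : s x₀ ∈ side r x₀ := by
      by_contra h
      exact hrs (hS.eq_of_mem_separating hX hW hstab hC hx₀ hs ⟨hr, h⟩)
    rwa [← side_eq hmem]

theorem IsMinimalReflectionSet.ncard_separating_lt (hX : IsCAT0 X) (hW : ActsProperly W)
    (hstab : ∀ g ∈ W, g '' C = C → g = 1)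
    (hC : IsChamber W C) (hS : IsMinimalReflectionSet W C S) {x₀ : X} (hx₀ : x₀ ∈ C)
    {s : X ≃ᵢ X} (hs : s ∈ S) {y : X} (hy : y ∈ offWalls W) (hsy : y ∉ side s x₀) :
    (separating W x₀ (s y)).ncard < (separating W x₀ y).ncard := by
  have hsR := hS.subset hs
  have hx₀W := hC.subset_offWalls hx₀
  have hx₀s := mem_offWalls.1 hx₀W s hsR
  rw [← ncard_separating_apply hsR.1 hx₀W, hsR.2.apply_apply]
  refine ncard_lt_ncard ⟨?_, fun h => ?_⟩ (hW.finite_separating hX _ _)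
  · rintro r ⟨hr, hry⟩
    refine ⟨hr, fun h => hry ?_⟩
    by_cases hrs : s x₀ ∈ side r x₀
    · rwa [← side_eq hrs]
    · obtain rfl := hS.eq_of_mem_separating hX hW hstab hC hx₀ hs ⟨hr, hrs⟩
      exact (hsy h).elim
  -- The wall of `s` drops out: `y` and `s x₀` are both on the side opposite to `x₀`.
  · refine (h ⟨hsR, hsy⟩).2 (hsR.2.mem_side_of_notMem_of_notMem hx₀s
      (hsR.2.apply_notMem_wall hx₀s) (mem_offWalls.1 hy s hsR) ?_ hsy)
    rw [hsR.2.apply_mem_side_iff hx₀s hx₀s]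
    exact not_not.2 (mem_side_self hx₀s)

/-- The number of walls separating `x₀` from `w x₀` is a lower bound for the word length. -/
theorem IsMinimalReflectionSet.ncard_separating_le_length (hX : IsCAT0 X) (hW : ActsProperly W)
    (hstab : ∀ g ∈ W, g '' C = C → g = 1)
    (hC : IsChamber W C) (hS : IsMinimalReflectionSet W C S) {x₀ : X} (hx₀ : x₀ ∈ C)
    (L : List (X ≃ᵢ X)) (hL : ∀ s ∈ L, s ∈ S) :
    (separating W x₀ (L.prod x₀)).ncard ≤ L.length := by
  induction L with
  | nil =>
    have : separating W x₀ x₀ = ∅ := eq_empty_of_forall_notMem fun r hr =>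
      hr.2 (mem_side_self (mem_offWalls.1 (hC.subset_offWalls hx₀) r hr.1))
    simp [this]
  | cons s L ih =>
    rw [List.prod_cons, IsometryEquiv.mul_apply, List.length_cons]
    refine (hS.ncard_separating_le hX hW hstab hC hx₀ (hL s List.mem_cons_self) _).trans ?_
    gcongr
    exact ih fun s' hs' => hL s' (List.mem_cons_of_mem _ hs')

/-- A geodesic with two points in the closed chamber stays there in between. -/
theorem IsMinimalReflectionSet.geodesic_mem_closure (hX : IsCAT0 X) (hW : ActsProperly W)
    (hC : IsChamber W C) (hS : IsMinimalReflectionSet W C S) {ξ : ℝ → X} {a b : X}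
    (hξ : IsGeodesic ξ a b) {t₁ t t₂ : ℝ} (h0 : 0 ≤ t₁) (h1 : t₁ ≤ t) (h2 : t ≤ t₂)
    (hd : t₂ ≤ dist a b) (hm₁ : ξ t₁ ∈ closure C) (hm₂ : ξ t₂ ∈ closure C) :
    ξ t ∈ closure C := by
  obtain ⟨x₀, hx₀⟩ : C.Nonempty := closure_nonempty_iff.1 ⟨_, hm₁⟩
  refine hS.mem_closure hX hW hC hx₀ fun s hs => ?_
  by_contra h
  rw [mem_union, not_or] at h
  -- A geodesic outside the half-space at time `t` has met the wall before and meets it again after,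
  -- contradicting convexity of the wall.
  obtain ⟨u₁, hu₁, hw₁⟩ : ∃ u ∈ Icc t₁ t, ξ u ∈ wall s := by
    rcases hC.closure_subset hX (hS.subset hs) hx₀ hm₁ with h' | h'
    · exact hξ.exists_mem_wall h0 h1 (h2.trans hd) (side_eq h' ▸ h.1)
    · exact ⟨t₁, ⟨le_rfl, h1⟩, h'⟩
  obtain ⟨u₂, hu₂, hw₂⟩ : ∃ u ∈ Icc t t₂, ξ u ∈ wall s := by
    rcases hC.closure_subset hX (hS.subset hs) hx₀ hm₂ with h' | h'
    · refine hξ.exists_mem_wall (h0.trans h1) h2 hd fun h'' => h.1 ?_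
      rw [side_eq h', ← side_eq h'']
      exact mem_side_self h.2
    · exact ⟨t₂, ⟨h2, le_rfl⟩, h'⟩
  exact h.2 (hX.geodConvex_wall s _ hw₁ _ hw₂
    (hξ.mem_geodSegment (h0.trans hu₁.1) hu₁.2 hu₂.1 (hu₂.2.trans hd)))

/-- A geodesic leaves the closed chamber through a wall of `S` that separates its endpoint from
the chamber. -/
theorem IsMinimalReflectionSet.exists_exit (hX : IsCAT0 X) (hW : ActsProperly W)
    (hC : IsChamber W C) (hS : IsMinimalReflectionSet W C S) {x₀ : X} (hx₀ : x₀ ∈ C)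
    {ξ : ℝ → X} {a b : X} (ha : a ∈ offWalls W) (hb : b ∈ offWalls W) (hbC : b ∉ C)
    (hξ : IsGeodesic ξ a b) {t : ℝ} (ht : t ∈ Icc 0 (dist a b)) (htC : ξ t ∈ closure C) :
    ∃ u ∈ Icc t (dist a b), ξ u ∈ closure C ∧ ∃ s ∈ S, ξ u ∈ wall s ∧ b ∉ side s x₀ := by
  have hbC' : b ∉ closure C := fun h => hbC <| (hS.mem_iff hC hx₀).2 fun s hs =>
    (hC.closure_subset hX (hS.subset hs) hx₀ h).resolve_right
      (mem_offWalls.1 hb s (hS.subset hs))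
  have hK : IsCompact (Icc t (dist a b) ∩ ξ ⁻¹' closure C) :=
    isCompact_Icc.of_isClosed_subset
      ((hξ.continuousOn.mono (Icc_subset_Icc_left ht.1)).preimage_isClosed_of_isClosed
        isClosed_Icc isClosed_closure) inter_subset_left
  obtain ⟨u, ⟨hu, huC⟩, hmax⟩ := hK.exists_isGreatest ⟨t, ⟨le_rfl, ht.2⟩, htC⟩
  refine ⟨u, hu, huC, ?_⟩
  have hu0 : 0 ≤ u := ht.1.trans hu.1
  have hud : u < dist a b := by
    refine lt_of_le_of_ne hu.2 fun h => hbC' ?_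
    rw [← hξ.target, ← h]
    exact huC
  obtain ⟨ε, hε, hlocal⟩ := hW.exists_forall_mem_wall (ξ u)
  -- `u` is the last time in the closed chamber. Just after it, a violated wall is so close to `ξ u`
  -- that it passes through it.
  obtain ⟨v, huv, hv⟩ : ∃ v, u < v ∧ v < min (dist a b) (u + ε) :=
    exists_between (lt_min hud (by linarith))
  rw [lt_min_iff] at hv
  have hvC : ξ v ∉ closure C := fun h =>
    absurd (hmax ⟨⟨hu.1.trans huv.le, hv.1.le⟩, h⟩) (not_le.2 huv)
  obtain ⟨s, hs, hsv⟩ : ∃ s ∈ S, ξ v ∉ side s x₀ ∪ wall s := by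
    by_contra! h
    exact hvC (hS.mem_closure hX hW hC hx₀ h)
  rw [mem_union, not_or] at hsv
  have hsR := hS.subset hs
  have hus : ξ u ∈ wall s := by
    rcases hC.closure_subset hX hsR hx₀ huC with h | h
    · obtain ⟨p, hp, hpw⟩ := hξ.exists_mem_wall hu0 huv.le hv.1.le (side_eq h ▸ hsv.1)
      refine hlocal s hsR _ hpw ?_
      rw [dist_comm, hξ.dist_of_le hu0 hp.1 (hp.2.trans hv.1.le)]
      linarith [hp.2]
    · exact h
  refine ⟨s, hs, hus, fun hbs => ?_⟩
  have hx₀s := mem_offWalls.1 (hC.subset_offWalls hx₀) s hsR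
  have has := mem_offWalls.1 ha s hsR
  have hconv : ∀ {x : X} {e : ℝ}, x ∉ wall s → u ≤ e → e ≤ dist a b → a ∈ side s x →
      ξ e ∈ side s x → False := by
    intro x e hx hue he h1 h2
    rw [← hξ.source] at h1
    exact side_subset s x (hsR.2.geodConvex_side hx _ h1 _ h2
      (hξ.mem_geodSegment le_rfl hu0 hue he)) hus
  -- If `b` were on the side of `x₀`, then `a` would share a side with either `b` or `ξ v`, and that
  -- convex side would contain the wall point `ξ u`.
  by_cases h : a ∈ side s x₀
  · refine hconv hx₀s hu.2 le_rfl h ?_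
    rwa [hξ.target]
  · exact hconv has huv.le hv.1.le (mem_side_self has)
      (hsR.2.mem_side_of_notMem_of_notMem hx₀s has hsv.2 h hsv.1)

/-- The chambers along a geodesic to `v x₀` form a gallery with no more steps than there are
separating walls. -/
theorem IsMinimalReflectionSet.exists_gallery (hX : IsCAT0 X) (hW : ActsProperly W)
    (hstab : ∀ g ∈ W, g '' C = C → g = 1)
    (hC : IsChamber W C) (hS : IsMinimalReflectionSet W C S) {x₀ : X} (hx₀ : x₀ ∈ C) (n : ℕ) :
    ∀ v ∈ W, (separating W x₀ (v x₀)).ncard ≤ n → ∀ (ξ : ℝ → X) (a : X), a ∈ offWalls W →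
      IsGeodesic ξ a (v x₀) → ∀ t ∈ Icc 0 (dist a (v x₀)), ξ t ∈ closure C →
      ∃ L : List (X ≃ᵢ X), (∀ s ∈ L, s ∈ S) ∧ L.prod = v ∧ L.length ≤ n ∧
        (∀ i < L.length, ∃ u ∈ Icc 0 (dist a (v x₀)), (L.take i).prod⁻¹ (ξ u) ∈ closure C ∧
          (L.take (i + 1)).prod⁻¹ (ξ u) ∈ closure C) ∧
        ∀ u ∈ Icc t (dist a (v x₀)), ∃ i ≤ L.length,
          (L.take i).prod⁻¹ (ξ u) ∈ closure C := by
  have hx₀W := hC.subset_offWalls hx₀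
  induction n using Nat.strong_induction_on with
  | _ n ih =>
    intro v hv hn ξ a ha hξ t ht htC
    by_cases hvC : v x₀ ∈ C
    · refine ⟨[], by simp, ?_, by simp, by simp, fun u hu => ⟨0, le_rfl, ?_⟩⟩
      · exact (hstab v hv (hC.image_eq hv hx₀ hvC)).symm
      · refine hS.geodesic_mem_closure hX hW hC hξ ht.1 hu.1 hu.2 le_rfl htC ?_
        rw [hξ.target]
        exact subset_closure hvC
    · have hvW := apply_mem_offWalls hv hx₀W
      -- `u = t` may occur where walls meet, so the induction runs on the number of separating
      -- walls, not on time.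
      obtain ⟨u, hu, huC, s, hs, hus, hsv⟩ :=
        hS.exists_exit hX hW hC hx₀ ha hvW hvC hξ ht htC
      have hsR := hS.subset hs
      have hlt := hS.ncard_separating_lt hX hW hstab hC hx₀ hs hvW hsv
      -- Rather than moving on to `s C`, fold the geodesic back by `s`, which fixes `ξ u`. It then
      -- starts at `s a`, which is why `a` need not lie in `C`.
      obtain ⟨L, hLS, hLv, hLn, hL1, hL2⟩ := ih _ (hlt.trans_le hn) (s * v) (W.mul_mem hsR.1 hv)
        le_rfl _ (s a) (apply_mem_offWalls hsR.1 ha)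
        (hξ.comp_isometryEquiv s) u
        (by
          rw [IsometryEquiv.mul_apply, s.dist_eq]
          exact ⟨ht.1.trans hu.1, hu.2⟩)
        (by rwa [mem_wall.1 hus])
      rw [IsometryEquiv.mul_apply, s.dist_eq] at hL1 hL2
      have hprod : ∀ (M : List (X ≃ᵢ X)) (z : X), (s :: M).prod⁻¹ z = M.prod⁻¹ (s z) := by
        intro M z
        rw [List.prod_cons, mul_inv_rev, hsR.2.inv_eq, IsometryEquiv.mul_apply]
      refine ⟨s :: L, ?_, ?_, hLn.trans_lt (hlt.trans_le hn), ?_, ?_⟩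
      · intro s' hs'
        rcases List.mem_cons.1 hs' with rfl | h
        · exact hs
        · exact hLS s' h
      · rw [List.prod_cons, hLv, ← mul_assoc, hsR.2.sq_eq_one, one_mul]
      · rintro (_ | i) hi
        · refine ⟨u, ⟨ht.1.trans hu.1, hu.2⟩, by simpa using huC, ?_⟩
          rw [List.take_succ_cons, hprod, mem_wall.1 hus]
          simpa using huC
        · obtain ⟨p, hp, hp1, hp2⟩ := hL1 i (by simpa using hi)
          refine ⟨p, hp, ?_, ?_⟩ <;> rwa [List.take_succ_cons, hprod]
      · intro p hp
        rcases le_total p u with hpu | hpu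
        · refine ⟨0, Nat.zero_le _, ?_⟩
          simpa using hS.geodesic_mem_closure hX hW hC hξ ht.1 hp.1 hpu hu.2 htC huC
        · obtain ⟨i, hi, hmem⟩ := hL2 p ⟨hpu, hp.2⟩
          refine ⟨i + 1, by simpa using hi, ?_⟩
          rwa [List.take_succ_cons, hprod]

theorem IsCAT0.left_mem_geodSegment (hX : IsCAT0 X) (x y : X) : x ∈ geodSegment x y := by
  obtain ⟨ξ, h⟩ := hX.geodesic x y
  exact ⟨ξ, h, 0, ⟨le_rfl, dist_nonneg⟩, h.source⟩

theorem IsCAT0.right_mem_geodSegment (hX : IsCAT0 X) (x y : X) : y ∈ geodSegment x y := by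
  obtain ⟨ξ, h⟩ := hX.geodesic x y
  exact ⟨ξ, h, _, ⟨dist_nonneg, le_rfl⟩, h.target⟩

theorem take_prod_apply_mem_wordPath (hX : IsCAT0 X) (x₀ : X) (L : List (X ≃ᵢ X)) {i : ℕ}
    (hi : i ≤ L.length) : (L.take i).prod x₀ ∈ wordPath x₀ L := by
  rcases i with _ | i
  · left
    simp
  · right
    exact mem_biUnion (Finset.mem_coe.2 (Finset.mem_range.2 hi)) (hX.right_mem_geodSegment _ _)

theorem edist_le_ediam_of_inv_apply_mem {A : Set X} {x y : X} (hx : x ∈ A) {g : X ≃ᵢ X}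
    (hy : g⁻¹ y ∈ A) : edist y (g x) ≤ ediam A := by
  have := edist_le_ediam_of_mem hy hx
  rwa [← g.edist_eq, IsometryEquiv.apply_inv_self] at this

theorem IsCAT0.edist_le_max (hX : IsCAT0 X) {a b p z : X} (hz : z ∈ geodSegment a b) :
    edist z p ≤ max (edist a p) (edist b p) := by
  simp only [edist_dist]
  rw [← ENNReal.ofReal_max]
  exact ENNReal.ofReal_le_ofReal (hX.dist_le_max hz)

end Galleries

end ReflCAT0

theorem mainTheorem3 {X : Type*} [MetricSpace X] (hX : ReflCAT0.IsCAT0 X)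
    (W : Subgroup (X ≃ᵢ X)) (hW : ReflCAT0.IsCocompactDiscreteReflectionGroup W)
    (C : Set X) (hC : ReflCAT0.IsChamber W C)
    (S : Set (X ≃ᵢ X)) (hS : ReflCAT0.IsMinimalReflectionSet W C S)
    (x₀ : X) (hx₀ : x₀ ∈ C) (w : X ≃ᵢ X) (hw : w ∈ W) :
    ∃ L : List (X ≃ᵢ X), ReflCAT0.IsReducedRepresentation S w L ∧
      Metric.hausdorffEDist (ReflCAT0.geodSegment x₀ (w x₀)) (ReflCAT0.wordPath x₀ L) ≤
        Metric.ediam (closure C) := by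
  have hP := hW.actsProperly
  have hstab := hW.stabilizer_trivial C hC
  obtain ⟨ξ, hξ⟩ := hX.geodesic x₀ (w x₀)
  have hx₀C : x₀ ∈ closure C := subset_closure hx₀
  obtain ⟨L, hLS, hLw, hLn, hL1, hL2⟩ := hS.exists_gallery hX hP hstab hC hx₀ _ w hw le_rfl ξ x₀
    (hC.subset_offWalls hx₀) hξ 0 ⟨le_rfl, dist_nonneg⟩ (by rwa [hξ.source])
  refine ⟨L, ⟨hLS, hLw, fun L' hL' hL'w => hLn.trans ?_⟩, ?_⟩
  · rw [← hL'w]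
    exact hS.ncard_separating_le_length hX hP hstab hC hx₀ L' hL'
  · refine Metric.hausdorffEDist_le_of_mem_edist ?_ ?_
    · rintro _ ⟨η, hη, t, ht, rfl⟩
      rw [hX.geodesic_unique hη hξ ht]
      obtain ⟨i, hi, hmem⟩ := hL2 t ht
      exact ⟨_, ReflCAT0.take_prod_apply_mem_wordPath hX x₀ L hi,
        ReflCAT0.edist_le_ediam_of_inv_apply_mem hx₀C hmem⟩
    · rintro z (hz | hz)
      · rw [Set.mem_singleton_iff] at hz
        refine ⟨x₀, hX.left_mem_geodSegment _ _, ?_⟩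
        rw [hz, edist_self]
        exact zero_le
      · simp only [Set.mem_iUnion, Finset.mem_range] at hz
        obtain ⟨i, hi, hz⟩ := hz
        obtain ⟨u, hu, hu1, hu2⟩ := hL1 i hi
        -- One point `ξ u`, common to both closed chambers, serves the whole segment by convexity of
        -- balls.
        refine ⟨ξ u, ⟨ξ, hξ, u, hu, rfl⟩, (hX.edist_le_max hz).trans (max_le ?_ ?_)⟩ <;>
          rw [edist_comm]
        · exact ReflCAT0.edist_le_ediam_of_inv_apply_mem hx₀C hu1
        · exact ReflCAT0.edist_le_ediam_of_inv_apply_mem hx₀C hu2
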